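/- A plane partition is an array $\pi=(\pi_{i,j})_{i,j\ge 1}$ of nonnegative integers with finitely many nonzero entries that is weakly decreasing in both indices, i.e. $\pi_{i,j}\ge \pi_{i+a,j+b}$ for all integers $i,j\ge 1$ and $a,b\ge 0$. Put $$w_-(\pi)=\sum_{i<j}\pi_{i,j},\qquad w_0(\pi)=\sum_{i=j}\pi_{i,j},\qquad w_+(\pi)=\sum_{i>j}\pi_{i,j},\qquad w(\pi)=w_-(\pi)+w_0(\pi)+w_+(\pi).$$ For integers $\delta,\ell$ and $n\ge 0$, let $b_\delta(\ell,n)$ be the (finite) number of plane partitions $\pi$ with $w(\pi)=n$ and $w_-(\pi)-w_+(\pi)+\delta\, w_0(\pi)=\ell$; in particular, $b_0(\ell,n)$ is the number of plane partitions of $n$ with $w_-(\pi)-w_+(\pi)=\ell$. **Theorem.** For all integers $m,n\ge 0$, $$b_0(m,n)\ge b_0(m+2,n).$$ -/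

import Mathlib

/-- A plane partition: a two-dimensional array of nonnegative integers `π i j`, weakly decreasing in
both indices, with finitely many nonzero entries. The indices start at `0`; the statistics below
depend on the two indices only through their comparison, so the starting index plays no role. -/
@[ext]
structure PlanePartition where
  entry : ℕ × ℕ →₀ ℕ
  decreasing : ∀ i j a b : ℕ, entry (i + a, j + b) ≤ entry (i, j)

namespace PlanePartition

/-- `w₋(π)`, the sum of the entries with `i < j`. -/
def wMinus (π : PlanePartition) : ℕ :=
  ∑ p ∈ π.entry.support with p.1 < p.2, π.entry p

/-- `w₀(π)`, the sum of the entries with `i = j`. -/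
def wZero (π : PlanePartition) : ℕ :=
  ∑ p ∈ π.entry.support with p.1 = p.2, π.entry p

/-- `w₊(π)`, the sum of the entries with `i > j`. -/
def wPlus (π : PlanePartition) : ℕ :=
  ∑ p ∈ π.entry.support with p.1 > p.2, π.entry p

/-- `w(π) = w₋(π) + w₀(π) + w₊(π)`. -/
def w (π : PlanePartition) : ℕ :=
  π.wMinus + π.wZero + π.wPlus

/-- `w(π)` is the total sum of the entries of `π`. -/
theorem w_eq_sum (π : PlanePartition) : π.w = ∑ p ∈ π.entry.support, π.entry p := by
  simp only [w, wMinus, wZero, wPlus, Finset.sum_filter, ← Finset.sum_add_distrib]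
  refine Finset.sum_congr rfl fun p _ => ?_
  rcases lt_trichotomy p.1 p.2 with h | h | h
  · simp [h, h.ne, h.le]
  · simp [h]
  · simp [h, h.ne', h.le]

/-- The set of plane partitions `π` with `w(π) = n` and `w₋(π) - w₊(π) + δ w₀(π) = ℓ`. -/
def refinedSet (δ ℓ : ℤ) (n : ℕ) : Set PlanePartition :=
  {π | π.w = n ∧ (π.wMinus : ℤ) - (π.wPlus : ℤ) + δ * (π.wZero : ℤ) = ℓ}

/-- The refined plane partition function `b_δ(ℓ, n)`: the number of plane partitions `π` with
`w(π) = n` and `w₋(π) - w₊(π) + δ w₀(π) = ℓ`. The set counted is finite (`refinedSet_finite`). -/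
noncomputable def b (δ ℓ : ℤ) (n : ℕ) : ℕ :=
  (refinedSet δ ℓ n).ncard

theorem support_subset (π : PlanePartition) :
    π.entry.support ⊆ Finset.range π.w ×ˢ Finset.range π.w := by
  have key : ∀ (f : ℕ → ℕ × ℕ), Function.Injective f → ∀ k : ℕ,
      (∀ x ≤ k, f x ∈ π.entry.support) → k < π.w := by
    intro f hf k h
    rw [w_eq_sum]
    calc k < ∑ _x ∈ Finset.range (k + 1), 1 := by simp
      _ ≤ ∑ x ∈ Finset.range (k + 1), π.entry (f x) := by
          refine Finset.sum_le_sum fun x hx => ?_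
          have := h x (by simpa [Nat.lt_succ_iff] using hx)
          exact Nat.one_le_iff_ne_zero.mpr (by simpa using this)
      _ = ∑ p ∈ (Finset.range (k + 1)).image f, π.entry p :=
          (Finset.sum_image fun x _ y _ e => hf e).symm
      _ ≤ _ := by
          refine Finset.sum_le_sum_of_subset fun p hp => ?_
          obtain ⟨x, hx, rfl⟩ := Finset.mem_image.mp hp
          exact h x (by simpa [Nat.lt_succ_iff] using hx)
  rintro ⟨i, j⟩ hp
  have hp' : π.entry (i, j) ≠ 0 := by simpa using hp
  simp only [Finset.mem_product, Finset.mem_range]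
  constructor
  · refine key (fun x => (x, j)) (fun x y e => by simpa using e) i fun x hx => ?_
    have := π.decreasing x j (i - x) 0
    rw [Nat.add_sub_cancel' hx, add_zero] at this
    simp only [Finsupp.mem_support_iff]
    omega
  · refine key (fun x => (i, x)) (fun x y e => by simpa using e) j fun x hx => ?_
    have := π.decreasing i x 0 (j - x)
    rw [Nat.add_sub_cancel' hx, add_zero] at this
    simp only [Finsupp.mem_support_iff]
    omega

theorem refinedSet_finite (δ ℓ : ℤ) (n : ℕ) : (refinedSet δ ℓ n).Finite := by
  have hinj : Function.Injective PlanePartition.entry := fun π σ h => PlanePartition.ext h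
  refine Set.Finite.of_finite_image (f := PlanePartition.entry) ?_ hinj.injOn
  refine ((Finset.range n ×ˢ Finset.range n).finsuppAntidiag n).finite_toSet.subset ?_
  rintro _ ⟨π, ⟨hw, -⟩, rfl⟩
  have hs := π.support_subset
  rw [hw] at hs
  rw [Finset.mem_coe, Finset.mem_finsuppAntidiag]
  refine ⟨?_, hs⟩
  refine (Finset.sum_subset hs fun p _ hp => by simpa using hp).symm.trans ?_
  rw [← w_eq_sum, hw]

end PlanePartition

/-!
The numbers `b 0 l n` are the weight multiplicities of a finite-dimensional representation of `sl₂`,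
for which the inequality is the injectivity of the lowering operator in positive weight.

*Product formula.* Plane partitions in the `N × N` square, rotated by a half turn, are reverse plane
partitions of the square. The toggle form of the Robinson-Schensted-Knuth correspondence
(`exists_bijOn_diagSum_eq_rectSum`) matches reverse plane partitions of a Young diagram with
arbitrary arrays on it, in such a way that each diagonal sum becomes a sum over a rectangle. The
statistics `w₋`, `w₀` and `w₊` are sums of diagonal sums, hence linear in the array, and undoing the
rotation shows that `π` corresponds to a multiset of cells `(i, j)` with total hook length
`∑ (i + j + 1) = w π` and total content `∑ (j - i) = w₋ π - w₊ π`
(`PlanePartition.exists_bijOn_weight`). Thus `b 0 l n` is the number of monomials of bidegree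
`(n, l)` in variables `X (i, j)` of bidegree `(i + j + 1, j - i)`
(`PlanePartition.b_zero_eq_ncard`).

*Action of `sl₂`.* The variables with `i + j + 1 = k` span a copy of the `k`-dimensional irreducible
representation of `sl₂`, with `X (i, j)` of weight `j - i`. The action extends by derivations to the
polynomial ring and preserves the first degree. A polynomial of positive weight that is killed by
the lowering operator would generate an infinite string of nonzero polynomials of unbounded weight
(`Cell.lowering_iterate_raising`), but the weight is at most the first degree. So the lowering
operator embeds the polynomials of bidegree `(n, m + 2)` into those of bidegree `(n, m)`, and
comparing dimensions gives the inequality (`Cell.ncard_weight_le`).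
-/

/-! ### Derivations and weights on polynomial rings -/

section

open MvPolynomial

/-- A derivation that shifts the weight of every variable by `c` shifts the weight of every weighted
homogeneous polynomial by `c`. -/
theorem Derivation.isWeightedHomogeneous_apply {σ R M : Type*} [CommRing R] [AddCommMonoid M]
    {w : σ → M} {D : Derivation R (MvPolynomial σ R) (MvPolynomial σ R)} {c : M}
    (hD : ∀ i, IsWeightedHomogeneous w (D (X i)) (w i + c)) {φ : MvPolynomial σ R} {m : M}
    (hφ : IsWeightedHomogeneous w φ m) : IsWeightedHomogeneous w (D φ) (m + c) := by
  induction hφ using IsWeightedHomogeneous.induction_on with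
  | zero => simpa using isWeightedHomogeneous_zero R w (m + c)
  | add p q _ _ hp hq => simpa using hp.add hq
  | monomial d r hd =>
    have hmk : D = mkDerivation R fun i => D (X i) := derivation_ext fun i => by simp
    rw [hmk, mkDerivation_monomial, Finsupp.sum, smul_eq_C_mul]
    refine IsWeightedHomogeneous.C_mul (.sum _ _ _ fun i hi => ?_) r
    have hle : Finsupp.single i 1 ≤ d := by
      simpa [Nat.one_le_iff_ne_zero] using hi
    have := (isWeightedHomogeneous_monomial w (d - Finsupp.single i 1) (d i : R) rfl).mul (hD i)
    rwa [← add_assoc, ← one_smul ℕ (w i), ← Finsupp.weight_single w i 1, ← map_add,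
      tsub_add_cancel_of_le hle, hd] at this

/-- A diagonal derivation acts on each monomial by a scalar, the weight of its exponent. -/
theorem mkDerivation_diagonal_monomial {σ R : Type*} [CommRing R] (c : σ → R) (d : σ →₀ ℕ)
    (r : R) :
    mkDerivation R (fun i => c i • (X i : MvPolynomial σ R)) (monomial d r)
      = Finsupp.weight c d • monomial d r := by
  rw [mkDerivation_monomial, Finsupp.weight_apply, Finsupp.sum, Finsupp.sum, Finset.sum_smul,
    Finset.smul_sum]
  refine Finset.sum_congr rfl fun i hi => ?_
  have hle : Finsupp.single i 1 ≤ d := by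
    simpa [Nat.one_le_iff_ne_zero] using hi
  rw [X, smul_monomial, smul_eq_mul, smul_eq_mul, monomial_mul, tsub_add_cancel_of_le hle,
    smul_monomial, smul_monomial]
  congr 1
  simp only [smul_eq_mul, nsmul_eq_mul]
  ring

theorem finrank_weightedHomogeneousSubmodule {σ R M : Type*} [CommRing R] [Nontrivial R]
    [AddCommMonoid M] (w : σ → M) (m : M) :
    Module.finrank R (weightedHomogeneousSubmodule R w m)
      = {d : σ →₀ ℕ | Finsupp.weight w d = m}.ncard := by
  rw [weightedHomogeneousSubmodule_eq_finsupp_supported]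
  exact Module.finrank_eq_nat_card_basis (basisRestrictSupport R _)

theorem finite_weightedHomogeneousSubmodule {σ R M : Type*} [CommRing R] [Nontrivial R]
    [AddCommMonoid M] (w : σ → M) (m : M) (h : {d : σ →₀ ℕ | Finsupp.weight w d = m}.Finite) :
    Module.Finite R (weightedHomogeneousSubmodule R w m) := by
  rw [weightedHomogeneousSubmodule_eq_finsupp_supported]
  have := h.to_subtype
  exact Module.Finite.of_basis (basisRestrictSupport R _)

/-! ### The action of `sl₂` on polynomials in the cells -/

namespace Cell

/-- The bidegree of the variable `X (i, j)`: its hook length `i + j + 1`, which records the size of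
a plane partition, and its content `j - i`, which is its `sl₂` weight. The cells of hook length `k`
have contents `-(k - 1), -(k - 3), …, k - 1`, the weights of the `k`-dimensional irreducible
representation. -/
def weight (p : ℕ × ℕ) : ℤ × ℤ := (p.1 + p.2 + 1, p.2 - p.1)

/-- The raising operator of `sl₂`, acting as a derivation. At `i = 0` the index `i - 1` is
truncated, but the coefficient `i` vanishes. -/
noncomputable def raising : Derivation ℚ (MvPolynomial (ℕ × ℕ) ℚ) (MvPolynomial (ℕ × ℕ) ℚ) :=
  mkDerivation ℚ fun p => (p.1 : ℚ) • X (p.1 - 1, p.2 + 1)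

/-- The lowering operator of `sl₂`, acting as a derivation. At `j = 0` the index `j - 1` is
truncated, but the coefficient `j` vanishes. -/
noncomputable def lowering : Derivation ℚ (MvPolynomial (ℕ × ℕ) ℚ) (MvPolynomial (ℕ × ℕ) ℚ) :=
  mkDerivation ℚ fun p => (p.2 : ℚ) • X (p.1 + 1, p.2 - 1)

theorem bracket_raising_lowering :
    ⁅raising, lowering⁆ = mkDerivation ℚ fun p => ((p.2 : ℚ) - p.1) • X p := by
  refine derivation_ext fun p => ?_
  obtain ⟨i, j⟩ := p
  rw [Derivation.commutator_apply, raising, lowering, mkDerivation_X, mkDerivation_X,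
    mkDerivation_X, Derivation.map_smul, Derivation.map_smul, mkDerivation_X, mkDerivation_X]
  rcases i with _ | i <;> rcases j with _ | j <;>
    simp only [Nat.add_sub_cancel, ← smul_assoc, ← sub_smul, smul_eq_mul, Nat.cast_zero, zero_mul,
      zero_smul, sub_zero, zero_sub, ← neg_smul] <;>
    congr 1 <;> push_cast <;> ring

theorem isWeightedHomogeneous_raising {φ : MvPolynomial (ℕ × ℕ) ℚ} {m : ℤ × ℤ}
    (hφ : IsWeightedHomogeneous weight φ m) :
    IsWeightedHomogeneous weight (raising φ) (m + (0, 2)) := by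
  refine Derivation.isWeightedHomogeneous_apply (fun p => ?_) hφ
  obtain ⟨i, j⟩ := p
  rw [raising, mkDerivation_X]
  rcases i with _ | i
  · simpa using isWeightedHomogeneous_zero ℚ weight _
  · rw [smul_eq_C_mul]
    have hw : weight (i + 1, j) + (0, 2) = weight (i, j + 1) := by
      ext <;> simp [weight] <;> ring
    rw [hw]
    exact (isWeightedHomogeneous_X ℚ weight (i, j + 1)).C_mul _

theorem isWeightedHomogeneous_lowering {φ : MvPolynomial (ℕ × ℕ) ℚ} {m : ℤ × ℤ}
    (hφ : IsWeightedHomogeneous weight φ m) :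
    IsWeightedHomogeneous weight (lowering φ) (m + (0, -2)) := by
  refine Derivation.isWeightedHomogeneous_apply (fun p => ?_) hφ
  obtain ⟨i, j⟩ := p
  rw [lowering, mkDerivation_X]
  rcases j with _ | j
  · simpa using isWeightedHomogeneous_zero ℚ weight _
  · rw [smul_eq_C_mul]
    have hw : weight (i, j + 1) + (0, -2) = weight (i + 1, j) := by
      ext <;> simp [weight] <;> ring
    rw [hw]
    exact (isWeightedHomogeneous_X ℚ weight (i + 1, j)).C_mul _

/-- The commutator of the raising and lowering operators acts on a bihomogeneous polynomial by its
`sl₂` weight. -/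
theorem bracket_apply {φ : MvPolynomial (ℕ × ℕ) ℚ} {m : ℤ × ℤ}
    (hφ : IsWeightedHomogeneous weight φ m) :
    raising (lowering φ) - lowering (raising φ) = (m.2 : ℚ) • φ := by
  rw [← Derivation.commutator_apply, bracket_raising_lowering]
  induction hφ using IsWeightedHomogeneous.induction_on with
  | zero => simp
  | add p q _ _ hp hq => rw [map_add, hp, hq, smul_add]
  | monomial d r hd =>
    rw [mkDerivation_diagonal_monomial, ← hd]
    congr 1
    simp [Finsupp.weight_apply, Finsupp.sum, weight, Prod.snd_sum]

theorem weight_eq_sum (d : ℕ × ℕ →₀ ℕ) : Finsupp.weight weight d =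
    (∑ p ∈ d.support, (d p : ℤ) * (p.1 + p.2 + 1), ∑ p ∈ d.support, (d p : ℤ) * (p.2 - p.1)) := by
  ext <;> simp [Finsupp.weight_apply, Finsupp.sum, weight, Prod.snd_sum, Prod.fst_sum]

theorem weight_snd_le_fst (d : ℕ × ℕ →₀ ℕ) :
    (Finsupp.weight weight d).2 ≤ (Finsupp.weight weight d).1 := by
  rw [weight_eq_sum]
  refine Finset.sum_le_sum fun p _ => mul_le_mul_of_nonneg_left ?_ (by positivity)
  omega

theorem sum_le_weight_fst (d : ℕ × ℕ →₀ ℕ) :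
    ∑ p ∈ d.support, (d p : ℤ) ≤ (Finsupp.weight weight d).1 := by
  rw [weight_eq_sum]
  exact Finset.sum_le_sum fun p _ => le_mul_of_one_le_right (by positivity) (by omega)

theorem support_subset_of_weight_fst {d : ℕ × ℕ →₀ ℕ} {n : ℕ}
    (hd : (Finsupp.weight weight d).1 = n) :
    d.support ⊆ Finset.range n ×ˢ Finset.range n := by
  intro p hp
  have h2 := Finset.single_le_sum (f := fun p => (d p : ℤ) * (p.1 + p.2 + 1))
    (fun p _ => by positivity) hp
  have h3 : (1 : ℤ) ≤ d p := by
    have := Finsupp.mem_support_iff.1 hp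
    omega
  rw [weight_eq_sum] at hd
  have h4 : (p.1 : ℤ) + p.2 + 1 ≤ n := by nlinarith
  simp only [Finset.mem_product, Finset.mem_range]
  omega

theorem finite_setOf_weight_eq (n : ℕ) (k : ℤ) :
    {d : ℕ × ℕ →₀ ℕ | Finsupp.weight weight d = ((n : ℤ), k)}.Finite := by
  refine (Set.Finite.biUnion (Finset.range (n + 1)).finite_toSet fun k _ =>
    ((Finset.range n ×ˢ Finset.range n).finsuppAntidiag k).finite_toSet).subset ?_
  rintro d hd
  have hd1 : (Finsupp.weight weight d).1 = n := congrArg Prod.fst hd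
  have hs := support_subset_of_weight_fst hd1
  refine Set.mem_biUnion (x := ∑ p ∈ d.support, d p) ?_ ?_
  · have := sum_le_weight_fst d
    simp only [Finset.coe_range, Set.mem_Iio]
    zify
    omega
  · rw [Finset.mem_coe, Finset.mem_finsuppAntidiag]
    exact ⟨(Finset.sum_subset hs fun p _ hp => by simpa using hp).symm, hs⟩

theorem eq_zero_of_fst_lt_snd {φ : MvPolynomial (ℕ × ℕ) ℚ} {m : ℤ × ℤ}
    (hφ : IsWeightedHomogeneous weight φ m) (hm : m.1 < m.2) : φ = 0 := by
  ext d
  refine hφ.coeff_eq_zero d fun h => ?_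
  have := weight_snd_le_fst d
  rw [h] at this
  omega

theorem isWeightedHomogeneous_iterate_raising {φ : MvPolynomial (ℕ × ℕ) ℚ} {m : ℤ × ℤ}
    (hφ : IsWeightedHomogeneous weight φ m) (r : ℕ) :
    IsWeightedHomogeneous weight (raising^[r] φ) (m + (0, 2 * (r : ℤ))) := by
  induction r with
  | zero => simpa [← Prod.zero_eq_mk] using hφ
  | succ r ih =>
    rw [Function.iterate_succ_apply']
    convert isWeightedHomogeneous_raising ih using 1
    ext <;> simp
    ring

/-- The standard `sl₂` computation on the string generated by a vector killed by the lowering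
operator. -/
theorem lowering_iterate_raising {φ : MvPolynomial (ℕ × ℕ) ℚ} {m : ℤ × ℤ}
    (hφ : IsWeightedHomogeneous weight φ m) (h : lowering φ = 0) (r : ℕ) :
    lowering (raising^[r + 1] φ) = (-((r + 1) * (m.2 + r)) : ℚ) • raising^[r] φ := by
  induction r with
  | zero =>
    have := bracket_apply hφ
    rw [h, map_zero, zero_sub, neg_eq_iff_eq_neg] at this
    simpa using this
  | succ r ih =>
    have := bracket_apply (isWeightedHomogeneous_iterate_raising hφ (r + 1))
    rw [ih, Derivation.map_smul, ← Function.iterate_succ_apply' raising,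
      ← Function.iterate_succ_apply' raising, sub_eq_iff_eq_add', ← sub_eq_iff_eq_add,
      ← sub_smul] at this
    rw [← this]
    congr 1
    simp only [Prod.snd_add]
    push_cast
    ring

/-- The lowering operator is injective in positive `sl₂` weight: if it kills `φ`, then raising `φ`
repeatedly gives zero only if `φ = 0`, while the `sl₂` weight is bounded by the hook degree, which
raising preserves. -/
theorem eq_zero_of_lowering_eq_zero {φ : MvPolynomial (ℕ × ℕ) ℚ} {m : ℤ × ℤ}
    (hφ : IsWeightedHomogeneous weight φ m) (hm : 0 < m.2) (h : lowering φ = 0) : φ = 0 := by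
  have key : ∀ r, raising^[r] φ = 0 → φ = 0 := by
    intro r
    induction r with
    | zero => exact id
    | succ r ih =>
      intro hr
      have h1 := lowering_iterate_raising hφ h r
      rw [hr, map_zero, eq_comm, smul_eq_zero] at h1
      refine ih (h1.resolve_left ?_)
      have : (0 : ℚ) < m.2 := by exact_mod_cast hm
      exact neg_ne_zero.2 (by positivity)
  -- Since `m.2 > 0`, raising more than `m.1` times makes the `sl₂` weight exceed the hook degree.
  refine key (m.1.toNat + 1)
    (eq_zero_of_fst_lt_snd (isWeightedHomogeneous_iterate_raising hφ _) ?_)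
  simp only [Prod.fst_add, Prod.snd_add]
  omega

/-- The lowering operator embeds the space of weight `k + 2` into that of weight `k`, in a fixed
hook degree `n`; the monomials are bases of these spaces. -/
theorem ncard_weight_le {n : ℕ} {k : ℤ} (hk : 0 ≤ k) :
    {d : ℕ × ℕ →₀ ℕ | Finsupp.weight weight d = ((n : ℤ), k + 2)}.ncard
      ≤ {d : ℕ × ℕ →₀ ℕ | Finsupp.weight weight d = ((n : ℤ), k)}.ncard := by
  rw [← finrank_weightedHomogeneousSubmodule (R := ℚ),
    ← finrank_weightedHomogeneousSubmodule (R := ℚ)]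
  have := finite_weightedHomogeneousSubmodule (R := ℚ) weight ((n : ℤ), k)
    (finite_setOf_weight_eq n k)
  have hmaps : ∀ φ ∈ weightedHomogeneousSubmodule ℚ weight ((n : ℤ), k + 2),
      (lowering : MvPolynomial (ℕ × ℕ) ℚ →ₗ[ℚ] MvPolynomial (ℕ × ℕ) ℚ) φ
        ∈ weightedHomogeneousSubmodule ℚ weight ((n : ℤ), k) := by
    intro φ hφ
    have := isWeightedHomogeneous_lowering ((mem_weightedHomogeneousSubmodule ℚ _ _ _).1 hφ)
    simpa using this
  refine LinearMap.finrank_le_finrank_of_injective (f := LinearMap.restrict _ hmaps) ?_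
  rw [← LinearMap.ker_eq_bot, LinearMap.ker_eq_bot']
  rintro ⟨φ, hφ⟩ h0
  have h1 : lowering φ = 0 := congrArg Subtype.val h0
  exact Subtype.ext (eq_zero_of_lowering_eq_zero hφ (by simp; omega) h1)

end Cell

end

/-! ### Toggles and reverse plane partitions -/

section

open Finset

/-- `IsRPP S F` says that `F` is a reverse plane partition of shape `S`: it vanishes outside `S` and
is weakly increasing in both indices on `S`. The entry at the cell `(i, j)` is `F (i + 1) (j + 1)`,
and `F` is zero on the border row and column of index `0`, so that every cell has an upper and a
left neighbour. -/
structure IsRPP (S : Finset (ℕ × ℕ)) (F : ℕ → ℕ → ℕ) : Prop where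
  left : ∀ i, F i 0 = 0
  top : ∀ j, F 0 j = 0
  outside : ∀ i j, (i, j) ∉ S → F (i + 1) (j + 1) = 0
  mono_row : ∀ i j, (i, j) ∈ S → F i (j + 1) ≤ F (i + 1) (j + 1)
  mono_col : ∀ i j, (i, j) ∈ S → F (i + 1) j ≤ F (i + 1) (j + 1)

/-- The smallest value that the cell `(i, j)` can take, given its upper and left neighbours. -/
def lowerBound (F : ℕ → ℕ → ℕ) (i j : ℕ) : ℕ := max (F i (j + 1)) (F (i + 1) j)

/-- The largest value that the cell `(i, j)` can take, given its lower and right neighbours. -/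
def upperBound (F : ℕ → ℕ → ℕ) (i j : ℕ) : ℕ := min (F (i + 2) (j + 1)) (F (i + 1) (j + 2))

/-- Toggle the cells strictly before `(a, b)` on the diagonal of `(a, b)`, that is, reflect the
value of each in the interval allowed by its four neighbours, and set the value at `(a, b)` to `v`.
The neighbours lie on the adjacent diagonals, hence are not changed. The subtraction is not
truncated on a reverse plane partition. -/
def toggleDiag (a b v : ℕ) (F : ℕ → ℕ → ℕ) : ℕ → ℕ → ℕ
  | i + 1, j + 1 =>
    if i = a ∧ j = b then v
    else if i + b = j + a ∧ i < a then lowerBound F i j + upperBound F i j - F (i + 1) (j + 1)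
    else F (i + 1) (j + 1)
  | i, j => F i j

section toggle

variable {S T : Finset (ℕ × ℕ)} {F : ℕ → ℕ → ℕ} {a b v : ℕ}

theorem toggleDiag_corner : toggleDiag a b v F (a + 1) (b + 1) = v := by simp [toggleDiag]

theorem toggleDiag_of_lt {i j : ℕ} (h : i + b = j + a) (hi : i < a) :
    toggleDiag a b v F (i + 1) (j + 1)
      = lowerBound F i j + upperBound F i j - F (i + 1) (j + 1) := by
  simp [toggleDiag, h, hi, hi.ne]

theorem toggleDiag_of_not {i j : ℕ} (h : ¬ (i + b = j + a ∧ i ≤ a + 1)) :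
    toggleDiag a b v F i j = F i j := by
  rcases i with _ | i
  · rfl
  rcases j with _ | j
  · rfl
  have h1 : ¬ (i = a ∧ j = b) := by omega
  have h2 : ¬ (i + b = j + a ∧ i < a) := by omega
  simp [toggleDiag, h1, h2]

theorem toggleDiag_of_ne {i j : ℕ} (h : i + b ≠ j + a) : toggleDiag a b v F i j = F i j :=
  toggleDiag_of_not fun h' => h h'.1

theorem toggleDiag_zero_left {j : ℕ} : toggleDiag a b v F 0 j = F 0 j := rfl

theorem toggleDiag_zero_right {i : ℕ} : toggleDiag a b v F i 0 = F i 0 := by cases i <;> rfl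

theorem lowerBound_toggleDiag {i j : ℕ} (h : i + b = j + a) :
    lowerBound (toggleDiag a b v F) i j = lowerBound F i j := by
  rw [lowerBound, lowerBound, toggleDiag_of_ne (by omega), toggleDiag_of_ne (by omega)]

theorem upperBound_toggleDiag {i j : ℕ} (h : i + b = j + a) :
    upperBound (toggleDiag a b v F) i j = upperBound F i j := by
  rw [upperBound, upperBound, toggleDiag_of_ne (by omega), toggleDiag_of_ne (by omega)]

theorem IsRPP.lowerBound_le (hF : IsRPP S F) {i j : ℕ} (h : (i, j) ∈ S) :
    lowerBound F i j ≤ F (i + 1) (j + 1) :=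
  max_le (hF.mono_row i j h) (hF.mono_col i j h)

theorem IsRPP.le_upperBound (hF : IsRPP S F)
    (hS : ∀ i j, i ≤ a → j ≤ b → (i, j) ≠ (a, b) → (i, j) ∈ S)
    {i j : ℕ} (h : i + b = j + a) (hi : i < a) : F (i + 1) (j + 1) ≤ upperBound F i j :=
  le_min (hF.mono_row (i + 1) j (hS _ _ (by omega) (by omega) (by simp; omega)))
    (hF.mono_col i (j + 1) (hS _ _ (by omega) (by omega) (by simp; omega)))

theorem IsRPP.toggleDiag_mem (hF : IsRPP S F)
    (hS : ∀ i j, i ≤ a → j ≤ b → (i, j) ≠ (a, b) → (i, j) ∈ S) {i j : ℕ} (h : i + b = j + a)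
    (hi : i < a) : lowerBound F i j ≤ toggleDiag a b v F (i + 1) (j + 1) ∧
      toggleDiag a b v F (i + 1) (j + 1) ≤ upperBound F i j := by
  have h1 := hF.lowerBound_le (hS i j (by omega) (by omega) (by simp; omega))
  have h2 := hF.le_upperBound hS h hi
  rw [toggleDiag_of_lt h hi]
  omega

/-- Toggling below the corner `(a, b)` turns a reverse plane partition of shape `S` into one of
shape `T`, where `S` and `T` may differ in the cell `(a, b)` only. It is used to remove the corner
(with `v = 0`) and to add it (with `v` at least its lower bound). -/
theorem IsRPP.isRPP_toggleDiag (hF : IsRPP S F) (hST : ∀ p, p ≠ (a, b) → (p ∈ S ↔ p ∈ T))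
    (hS : ∀ i j, i ≤ a → j ≤ b → (i, j) ≠ (a, b) → (i, j) ∈ S)
    (hrow : (a + 1, b) ∉ T) (hcol : (a, b + 1) ∉ T) (hv0 : (a, b) ∉ T → v = 0)
    (hv : (a, b) ∈ T → lowerBound F a b ≤ v) : IsRPP T (toggleDiag a b v F) where
  left i := by rw [toggleDiag_zero_right, hF.left]
  top j := by rw [toggleDiag_zero_left, hF.top]
  outside i j hij := by
    by_cases hc : (i, j) = (a, b)
    · obtain ⟨rfl, rfl⟩ := Prod.mk.inj hc
      rw [toggleDiag_corner, hv0 hij]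
    · have hij' : (i, j) ∉ S := fun h => hij ((hST _ hc).1 h)
      rw [toggleDiag_of_not, hF.outside i j hij']
      rintro ⟨h1, h2⟩
      exact hij' (hS i j (by omega) (by omega) hc)
  mono_row i j hij := by
    by_cases hc : (i, j) = (a, b)
    · obtain ⟨rfl, rfl⟩ := Prod.mk.inj hc
      rw [toggleDiag_corner, toggleDiag_of_ne (by omega)]
      exact (le_max_left _ _).trans (hv hij)
    · by_cases hd : i + b = j + a ∧ i < a
      · rw [toggleDiag_of_ne (by omega)]
        exact (le_max_left _ _).trans (hF.toggleDiag_mem hS hd.1 hd.2).1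
      · rw [toggleDiag_of_not (i := i + 1) (by simp at hc; omega)]
        by_cases hd' : i + b = j + 1 + a ∧ i ≤ a + 1
        · obtain _ | i := i
          · rw [toggleDiag_zero_left, hF.top]
            exact Nat.zero_le _
          · rcases hd'.2.lt_or_eq with hlt | heq
            · exact (hF.toggleDiag_mem hS (by omega) (by omega)).2.trans (min_le_left _ _)
            · obtain rfl : i = a := by omega
              obtain rfl : j = b := by omega
              exact absurd hij hrow
        · rw [toggleDiag_of_not hd']
          exact hF.mono_row i j ((hST _ hc).2 hij)
  mono_col i j hij := by
    by_cases hc : (i, j) = (a, b)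
    · obtain ⟨rfl, rfl⟩ := Prod.mk.inj hc
      rw [toggleDiag_corner, toggleDiag_of_ne (by omega)]
      exact (le_max_right _ _).trans (hv hij)
    · by_cases hd : i + b = j + a ∧ i < a
      · rw [toggleDiag_of_ne (i := i + 1) (j := j) (by omega)]
        exact (le_max_right _ _).trans (hF.toggleDiag_mem hS hd.1 hd.2).1
      · rw [toggleDiag_of_not (j := j + 1) (by simp at hc; omega)]
        by_cases hd' : i + 1 + b = j + a ∧ i ≤ a
        · obtain _ | j := j
          · rw [toggleDiag_zero_right, hF.left]
            exact Nat.zero_le _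
          · rcases hd'.2.lt_or_eq with hlt | heq
            · exact (hF.toggleDiag_mem hS (by omega) (by omega)).2.trans (min_le_right _ _)
            · obtain rfl : i = a := by omega
              obtain rfl : j = b := by omega
              exact absurd hij hcol
        · rw [toggleDiag_of_not (by omega)]
          exact hF.mono_col i j ((hST _ hc).2 hij)

/-- Toggling is an involution, once the value at the corner is restored. -/
theorem IsRPP.toggleDiag_toggleDiag (hF : IsRPP S F)
    (hS : ∀ i j, i ≤ a → j ≤ b → (i, j) ≠ (a, b) → (i, j) ∈ S) :
    toggleDiag a b (F (a + 1) (b + 1)) (toggleDiag a b v F) = F := by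
  funext i j
  obtain _ | i := i
  · rfl
  obtain _ | j := j
  · rfl
  by_cases hc : i = a ∧ j = b
  · obtain ⟨rfl, rfl⟩ := hc
    rw [toggleDiag_corner]
  · by_cases hd : i + b = j + a ∧ i < a
    · rw [toggleDiag_of_lt hd.1 hd.2, lowerBound_toggleDiag hd.1, upperBound_toggleDiag hd.1,
        toggleDiag_of_lt hd.1 hd.2]
      have h1 := hF.lowerBound_le (hS i j (by omega) (by omega) (by simp; omega))
      have h2 := hF.le_upperBound hS hd.1 hd.2
      omega
    · rw [toggleDiag_of_not (by omega), toggleDiag_of_not (by omega)]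

end toggle

/-- The sum of the entries of `F` on the diagonal that ends at index `(i, j)`, that is, of
`F i j + F (i - 1) (j - 1) + ⋯` down to the border. -/
def diagSum (F : ℕ → ℕ → ℕ) : ℕ → ℕ → ℕ
  | i + 1, j + 1 => F (i + 1) (j + 1) + diagSum F i j
  | _, _ => 0

/-- The sum of `A` over the rectangle of the cells `(x, y)` with `x < i` and `y < j`. -/
def rectSum (A : ℕ × ℕ → ℕ) (i j : ℕ) : ℕ := ∑ x ∈ range i, ∑ y ∈ range j, A (x, y)

theorem rectSum_succ_succ (A : ℕ × ℕ → ℕ) (i j : ℕ) :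
    rectSum A (i + 1) (j + 1) + rectSum A i j
      = rectSum A i (j + 1) + rectSum A (i + 1) j + A (i, j) := by
  simp only [rectSum, sum_range_succ, sum_add_distrib]
  ring

theorem rectSum_congr {A B : ℕ × ℕ → ℕ} {i j : ℕ} (h : ∀ x < i, ∀ y < j, A (x, y) = B (x, y)) :
    rectSum A i j = rectSum B i j :=
  sum_congr rfl fun x hx => sum_congr rfl fun y hy => h x (mem_range.1 hx) y (mem_range.1 hy)

theorem diagSum_congr {F G : ℕ → ℕ → ℕ} : ∀ {i j : ℕ},
    (∀ x y, x ≤ i → x + j = y + i → F x y = G x y) → diagSum F i j = diagSum G i j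
  | 0, _, _ => by simp [diagSum]
  | _ + 1, 0, _ => by simp [diagSum]
  | i + 1, j + 1, h => by
    rw [diagSum, diagSum, h _ _ le_rfl (by omega),
      diagSum_congr fun x y hx hy => h x y (by omega) (by omega)]

/-- The sums of a diagonal before and after toggling add up to the sums of the two adjacent
diagonals, up to the lower bound at the end, by `max x y + min x y = x + y`. -/
theorem diagSum_add_diagSum_toggleDiag {S : Finset (ℕ × ℕ)} {F : ℕ → ℕ → ℕ} {a b v : ℕ}
    (hF : IsRPP S F) (hS : ∀ i j, i ≤ a → j ≤ b → (i, j) ≠ (a, b) → (i, j) ∈ S) :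
    ∀ i j, i + b = j + a → i ≤ a →
      diagSum F i j + diagSum (toggleDiag a b v F) i j + lowerBound F i j
        = diagSum F i (j + 1) + diagSum F (i + 1) j
  | 0, j, _, _ => by
    rcases j with _ | j <;> simp [diagSum, lowerBound, hF.top, hF.left]
  | i + 1, 0, _, _ => by simp [diagSum, lowerBound, hF.left]
  | i + 1, j + 1, h, hi => by
    have ih := diagSum_add_diagSum_toggleDiag (v := v) hF hS i j (by omega) (by omega)
    have h1 := hF.lowerBound_le (hS i j (by omega) (by omega) (by simp; omega))
    have h2 := hF.le_upperBound hS (i := i) (j := j) (by omega) (by omega)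
    -- The upper bound of a cell and the lower bound of the next one on the diagonal involve the
    -- same two neighbours.
    have h3 : upperBound F i j + lowerBound F (i + 1) (j + 1)
        = F (i + 2) (j + 1) + F (i + 1) (j + 2) := by
      rw [upperBound, lowerBound, max_comm]
      exact min_add_max _ _
    simp only [diagSum]
    rw [toggleDiag_of_lt (by omega) (by omega)]
    simp only [add_assoc, Nat.reduceAdd] at *
    omega

/-- Reverse plane partitions of shape `S` are in bijection with arbitrary arrays on `S`, such that
the sum of each complete diagonal is the sum of the array over the rectangle spanned by its last
cell. A diagonal is complete if it ends at an index `(i, j)` whose cell `(i - 1, j - 1)` lies in `S`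
while `(i, j)` does not lie in `S`; indices on the border stand for empty diagonals. The bijection
is built by removing a corner of `S`: the corner entry minus its lower bound becomes the entry of
the array, and the rest of the diagonal is toggled. -/
theorem exists_bijOn_diagSum_eq_rectSum (S : Finset (ℕ × ℕ)) (hS : IsLowerSet (S : Set (ℕ × ℕ))) :
    ∃ Φ : (ℕ → ℕ → ℕ) → (ℕ × ℕ → ℕ),
      Set.BijOn Φ {F | IsRPP S F} {A | ∀ p ∉ S, A p = 0} ∧
      ∀ F, IsRPP S F → ∀ i j, (i, j) ∉ S → (∀ x y, i = x + 1 → j = y + 1 → (x, y) ∈ S) →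
        diagSum F i j = rectSum (Φ F) i j := by
  induction hn : #S generalizing S with
  | zero =>
    obtain rfl := card_eq_zero.1 hn
    have hF0 : ∀ F, IsRPP ∅ F → F = 0 := by
      intro F hF
      funext i j
      rcases i with _ | i
      · exact hF.top j
      rcases j with _ | j
      · exact hF.left _
      exact hF.outside i j (by simp)
    refine ⟨fun _ => 0, ⟨fun _ _ _ _ => rfl, fun F hF G hG _ => (hF0 F hF).trans (hF0 G hG).symm,
      fun A hA => ⟨0, ⟨?_, ?_, ?_, ?_, ?_⟩, funext fun p => (hA p (by simp)).symm⟩⟩, ?_⟩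
    · simp
    · simp
    · simp
    · simp
    · simp
    intro F hF i j _ h
    rcases i with _ | i
    · simp [diagSum, rectSum]
    rcases j with _ | j
    · simp [diagSum, rectSum]
    · simpa using h i j rfl rfl
  | succ n ih =>
    obtain ⟨⟨a, b⟩, hmax⟩ := S.exists_maximal (card_pos.1 (by omega))
    have hc : (a, b) ∈ S := hmax.prop
    have hbelow : ∀ i j, i ≤ a → j ≤ b → (i, j) ∈ S := fun i j hi hj =>
      hS (Prod.mk_le_mk.2 ⟨hi, hj⟩) hc
    have habove : ∀ i j, a ≤ i → b ≤ j → (i, j) ≠ (a, b) → (i, j) ∉ S := by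
      intro i j hi hj hne hij
      exact hne (le_antisymm (hmax.le_of_ge hij (Prod.mk_le_mk.2 ⟨hi, hj⟩))
        (Prod.mk_le_mk.2 ⟨hi, hj⟩))
    set T := S.erase (a, b) with hT
    have hTS : ∀ p, p ≠ (a, b) → (p ∈ T ↔ p ∈ S) := fun p hp => by simp [hT, hp]
    have hcT : (a, b) ∉ T := by simp [hT]
    have hbelowT : ∀ i j, i ≤ a → j ≤ b → (i, j) ≠ (a, b) → (i, j) ∈ T := fun i j hi hj hne =>
      (hTS _ hne).2 (hbelow i j hi hj)
    have hTlow : IsLowerSet (T : Set (ℕ × ℕ)) := by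
      rintro ⟨i, j⟩ ⟨k, l⟩ hle hp
      have hp' : (i, j) ∈ S := mem_of_mem_erase hp
      refine mem_erase.2 ⟨?_, hS hle hp'⟩
      intro he
      obtain ⟨rfl, rfl⟩ := Prod.mk.inj he
      obtain ⟨h1, h2⟩ := Prod.mk_le_mk.1 hle
      exact habove i j h1 h2 (ne_of_mem_erase hp) hp'
    obtain ⟨Φ, hΦ, hsum⟩ := ih T hTlow (by rw [hT, card_erase_of_mem hc]; omega)
    have hdown : ∀ F, IsRPP S F → IsRPP T (toggleDiag a b 0 F) := fun F hF =>
      hF.isRPP_toggleDiag (fun p hp => (hTS p hp).symm) (fun i j hi hj _ => hbelow i j hi hj)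
        (fun h => habove _ _ (by omega) le_rfl (by simp) (mem_of_mem_erase h))
        (fun h => habove _ _ le_rfl (by omega) (by simp) (mem_of_mem_erase h))
        (fun _ => rfl) (fun h => absurd h hcT)
    have hup : ∀ F, IsRPP T F → ∀ x, IsRPP S (toggleDiag a b (lowerBound F a b + x) F) :=
      fun F hF x => hF.isRPP_toggleDiag hTS hbelowT
        (habove _ _ (by omega) le_rfl (by simp)) (habove _ _ le_rfl (by omega) (by simp))
        (fun h => absurd hc h) (fun _ => Nat.le_add_right _ _)
    have hΦc : ∀ F, IsRPP T F → Φ F (a, b) = 0 := fun F hF => hΦ.mapsTo hF _ hcT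
    -- The entry of the array at the corner is the excess of `F` over its lower bound there.
    refine ⟨fun F => Function.update (Φ (toggleDiag a b 0 F)) (a, b)
      (F (a + 1) (b + 1) - lowerBound F a b), ⟨?_, ?_, ?_⟩, ?_⟩
    · intro F hF p hp
      have hne : p ≠ (a, b) := fun h => hp (h ▸ hc)
      simp only [Function.update_of_ne hne]
      exact hΦ.mapsTo (hdown F hF) p fun h => hp (mem_of_mem_erase h)
    · intro F hF G hG h
      have hFG : toggleDiag a b 0 F = toggleDiag a b 0 G := by
        refine hΦ.injOn (hdown F hF) (hdown G hG) (funext fun p => ?_)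
        by_cases hp : p = (a, b)
        · rw [hp, hΦc _ (hdown F hF), hΦc _ (hdown G hG)]
        · simpa [Function.update_of_ne hp] using congrFun h p
      have hlow : lowerBound F a b = lowerBound G a b := by
        rw [← lowerBound_toggleDiag (a := a) (b := b) (v := 0) (add_comm a b), hFG,
          lowerBound_toggleDiag (add_comm a b)]
      have hval : F (a + 1) (b + 1) = G (a + 1) (b + 1) := by
        have h1 := congrFun h (a, b)
        simp only [Function.update_self] at h1
        have h2 := hF.lowerBound_le hc
        have h3 := IsRPP.lowerBound_le hG hc
        omega
      rw [← IsRPP.toggleDiag_toggleDiag (v := 0) hF fun i j hi hj _ => hbelow i j hi hj, hFG, hval,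
        IsRPP.toggleDiag_toggleDiag (v := 0) hG fun i j hi hj _ => hbelow i j hi hj]
    · intro A hA
      obtain ⟨G, hG, hGA⟩ := hΦ.surjOn (show Function.update A (a, b) 0 ∈ _ by
        intro p hp
        by_cases hpc : p = (a, b)
        · simp [hpc]
        · rw [Function.update_of_ne hpc]
          exact hA p fun h => hp ((hTS p hpc).2 h))
      refine ⟨_, hup G hG (A (a, b)), ?_⟩
      have h0 : toggleDiag a b 0 (toggleDiag a b (lowerBound G a b + A (a, b)) G) = G := by
        have := IsRPP.toggleDiag_toggleDiag (v := lowerBound G a b + A (a, b)) hG hbelowT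
        rwa [IsRPP.outside hG a b hcT] at this
      simp only [h0, hGA, toggleDiag_corner]
      simp [lowerBound_toggleDiag (add_comm a b)]
    · intro F hF i j hij hcor
      -- For the diagonal ending at the corner, inclusion-exclusion of rectangles matches the
      -- relation between the sums of the toggled diagonal and of its neighbours.
      by_cases hc' : (i, j) = (a + 1, b + 1)
      · obtain ⟨rfl, rfl⟩ := Prod.mk.inj hc'
        set G := toggleDiag a b 0 F
        have hG : IsRPP T G := hdown F hF
        have e1 := hsum G hG a b hcT
          fun x y hx hy => hbelowT x y (by omega) (by omega) (by simp; omega)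
        have e2 := hsum G hG (a + 1) b
          (fun h => habove _ _ (by omega) le_rfl (by simp) (mem_of_mem_erase h))
          fun x y hx hy => hbelowT x y (by omega) (by omega) (by simp; omega)
        have e3 := hsum G hG a (b + 1)
          (fun h => habove _ _ le_rfl (by omega) (by simp) (mem_of_mem_erase h))
          fun x y hx hy => hbelowT x y (by omega) (by omega) (by simp; omega)
        have hd : diagSum F a b + diagSum G a b + lowerBound F a b
            = diagSum F a (b + 1) + diagSum F (a + 1) b :=
          diagSum_add_diagSum_toggleDiag hF (fun i j hi hj _ => hbelow i j hi hj) a b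
            (add_comm a b) le_rfl
        have d2 : diagSum G (a + 1) b = diagSum F (a + 1) b :=
          diagSum_congr fun x y _ _ => toggleDiag_of_ne (by omega)
        have d3 : diagSum G a (b + 1) = diagSum F a (b + 1) :=
          diagSum_congr fun x y _ _ => toggleDiag_of_ne (by omega)
        have hr := rectSum_succ_succ (Function.update (Φ G) (a, b)
          (F (a + 1) (b + 1) - lowerBound F a b)) a b
        have r : ∀ i j, (i ≤ a ∨ j ≤ b) → rectSum (Function.update (Φ G) (a, b)
            (F (a + 1) (b + 1) - lowerBound F a b)) i j = rectSum (Φ G) i j := by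
          intro i j h
          refine rectSum_congr fun x hx y hy => Function.update_of_ne ?_ _ _
          simp only [ne_eq, Prod.mk.injEq]
          omega
        rw [r a b (by simp), r a (b + 1) (by simp), r (a + 1) b (by simp),
          Function.update_self] at hr
        have hle := hF.lowerBound_le hc
        change F (a + 1) (b + 1) + diagSum F a b = rectSum (Function.update (Φ G) (a, b)
          (F (a + 1) (b + 1) - lowerBound F a b)) (a + 1) (b + 1)
        omega
      -- The only complete diagonal on the diagonal of the corner ends at the corner, so any other
      -- one misses the toggled cells, and its rectangle misses the corner.
      · have hne : (i : ℤ) - j ≠ a - b := by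
          intro he
          have hlt : i ≤ a ∨ a + 1 < i := by
            simp only [Prod.mk.injEq] at hc'
            omega
          rcases hlt with hlt | hlt
          · exact hij (hbelow i j hlt (by omega))
          · refine habove (i - 1) (j - 1) (by omega) (by omega) ?_
              (hcor (i - 1) (j - 1) (by omega) (by omega))
            simp only [ne_eq, Prod.mk.injEq]
            omega
        have hcor' : ∀ x y, i = x + 1 → j = y + 1 → (x, y) ∈ T := by
          intro x y hx hy
          refine (hTS _ ?_).2 (hcor x y hx hy)
          simp only [ne_eq, Prod.mk.injEq]
          omega
        have h1 := hsum _ (hdown F hF) i j (fun h => hij (mem_of_mem_erase h)) hcor'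
        rw [diagSum_congr fun x y _ _ => toggleDiag_of_ne (by omega)] at h1
        rw [h1]
        refine rectSum_congr fun x hx y hy => (Function.update_of_ne ?_ _ _).symm
        intro he
        obtain ⟨rfl, rfl⟩ := Prod.mk.inj he
        refine habove (i - 1) (j - 1) (by omega) (by omega) ?_
              (hcor (i - 1) (j - 1) (by omega) (by omega))
        simp only [ne_eq, Prod.mk.injEq]
        omega

/-! ### Rectangle sums over the square -/

/-- Terms with `t ≥ min i j` vanish, because truncated subtraction sends them to the border. -/
theorem diagSum_eq_sum {F : ℕ → ℕ → ℕ} (hl : ∀ i, F i 0 = 0) (ht : ∀ j, F 0 j = 0) :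
    ∀ {K i j : ℕ}, min i j ≤ K → diagSum F i j = ∑ t ∈ range K, F (i - t) (j - t)
  | K, 0, j, _ => by simp [diagSum, ht]
  | K, i + 1, 0, _ => by simp [diagSum, hl]
  | 0, i + 1, j + 1, h => by omega
  | K + 1, i + 1, j + 1, h => by
    rw [diagSum, sum_range_succ', diagSum_eq_sum hl ht (K := K) (by omega), add_comm]
    simp

theorem sum_range_sum_range (g : ℕ → ℕ) (N : ℕ) :
    ∑ k ∈ range N, ∑ y ∈ range k, g y = ∑ y ∈ range N, g y * (N - 1 - y) := by
  induction N with
  | zero => simp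
  | succ N ih =>
    rw [sum_range_succ, ih, ← sum_add_distrib, sum_range_succ]
    simp only [Nat.add_sub_cancel, Nat.sub_self, mul_zero, add_zero]
    refine sum_congr rfl fun y hy => ?_
    rw [mem_range] at hy
    rw [show N - y = N - 1 - y + 1 by omega]
    ring

theorem sum_rectSum_right (A : ℕ × ℕ → ℕ) (N : ℕ) :
    ∑ k ∈ range N, rectSum A N k = ∑ x ∈ range N, ∑ y ∈ range N, A (x, y) * (N - 1 - y) := by
  simp only [rectSum]
  rw [sum_comm]
  exact sum_congr rfl fun x _ => sum_range_sum_range _ _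

theorem sum_rectSum_left (A : ℕ × ℕ → ℕ) (N : ℕ) :
    ∑ k ∈ range N, rectSum A k N = ∑ x ∈ range N, ∑ y ∈ range N, A (x, y) * (N - 1 - x) := by
  simp only [rectSum]
  rw [sum_range_sum_range]
  exact sum_congr rfl fun x _ => sum_mul _ _ _

/-- The array on the `N × N` square obtained from `A` by rotating the square by a half turn. -/
noncomputable def reflect (N : ℕ) (A : ℕ × ℕ → ℕ) : ℕ × ℕ →₀ ℕ :=
  Finsupp.onFinset (range N ×ˢ range N)
    (fun p => if p ∈ range N ×ˢ range N then A (N - 1 - p.1, N - 1 - p.2) else 0)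
    fun p hp => by
      by_contra h
      exact hp (if_neg h)

theorem reflect_apply {N : ℕ} {A : ℕ × ℕ → ℕ} {x y : ℕ} (hx : x < N) (hy : y < N) :
    reflect N A (x, y) = A (N - 1 - x, N - 1 - y) := by
  simp [reflect, hx, hy]

theorem support_reflect (N : ℕ) (A : ℕ × ℕ → ℕ) :
    (reflect N A).support ⊆ range N ×ˢ range N :=
  Finsupp.support_onFinset_subset

theorem bijOn_reflect (N : ℕ) :
    Set.BijOn (reflect N) {A | ∀ p ∉ range N ×ˢ range N, A p = 0}
      {d | d.support ⊆ range N ×ˢ range N} := by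
  refine ⟨fun A _ => support_reflect N A, fun A hA B hB h => ?_, fun d hd => ?_⟩
  · funext ⟨x, y⟩
    by_cases hp : (x, y) ∈ range N ×ˢ range N
    · have h1 := DFunLike.congr_fun h (N - 1 - x, N - 1 - y)
      simp only [mem_product, mem_range] at hp
      rw [reflect_apply (by omega) (by omega), reflect_apply (by omega) (by omega)] at h1
      rwa [show N - 1 - (N - 1 - x) = x by omega, show N - 1 - (N - 1 - y) = y by omega] at h1
    · rw [hA _ hp, hB _ hp]
  · refine ⟨reflect N d,
      fun p hp => Finsupp.notMem_support_iff.1 fun h => hp (support_reflect N _ h), ?_⟩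
    ext ⟨x, y⟩
    by_cases hp : (x, y) ∈ range N ×ˢ range N
    · simp only [mem_product, mem_range] at hp
      rw [reflect_apply (by omega) (by omega), reflect_apply (by omega) (by omega)]
      rw [show N - 1 - (N - 1 - x) = x by omega, show N - 1 - (N - 1 - y) = y by omega]
    · rw [Finsupp.notMem_support_iff.1 fun h => hp (hd h),
        Finsupp.notMem_support_iff.1 fun h => hp (support_reflect N _ h)]

/-- After the half turn, `A (x, y)` contributes to `N - 1 - y` of the rectangles of full height `N`
and to `N - 1 - x` of those of full width `N`, apart from the whole square: this turns rectangle
sums into hook lengths and contents. -/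
theorem weight_reflect (N : ℕ) (A : ℕ × ℕ → ℕ) :
    Finsupp.weight Cell.weight (reflect N A) =
      (((∑ k ∈ range N, rectSum A N k + rectSum A N N + ∑ k ∈ range N, rectSum A k N : ℕ) : ℤ),
        ((∑ k ∈ range N, rectSum A N k : ℕ) : ℤ) - (∑ k ∈ range N, rectSum A k N : ℕ)) := by
  have key : ∀ f : ℕ → ℕ → ℤ, ∑ p ∈ (reflect N A).support, (reflect N A p : ℤ) * f p.1 p.2
      = ∑ x ∈ range N, ∑ y ∈ range N, (A (x, y) : ℤ) * f (N - 1 - x) (N - 1 - y) := by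
    intro f
    rw [sum_subset (support_reflect N A) fun p _ hp => by
      rw [Finsupp.notMem_support_iff.1 hp, Nat.cast_zero, zero_mul], sum_product,
      ← sum_range_reflect]
    refine sum_congr rfl fun x hx => ?_
    rw [← sum_range_reflect]
    refine sum_congr rfl fun y hy => ?_
    rw [mem_range] at hx hy
    rw [reflect_apply (by omega) (by omega), show N - 1 - (N - 1 - x) = x by omega,
      show N - 1 - (N - 1 - y) = y by omega]
  rw [Cell.weight_eq_sum, key fun i j => (i : ℤ) + j + 1, key fun i j => (j : ℤ) - i,
    sum_rectSum_left, sum_rectSum_right, rectSum]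
  push_cast
  simp only [← sum_add_distrib, ← sum_sub_distrib]
  rw [Prod.mk.injEq]
  constructor
  · refine sum_congr rfl fun x _ => sum_congr rfl fun y _ => ?_
    ring
  · refine sum_congr rfl fun x _ => sum_congr rfl fun y _ => ?_
    ring

/-! ### Plane partitions in the square -/

namespace PlanePartition

/-- The plane partition `π`, restricted to the `N × N` square, rotated by a half turn and shifted by
one, as a reverse plane partition. -/
def reversedArray (N : ℕ) (π : PlanePartition) (i j : ℕ) : ℕ :=
  if 0 < i ∧ i ≤ N ∧ 0 < j ∧ j ≤ N then π.entry (N - i, N - j) else 0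

theorem entry_le (π : PlanePartition) {i j k l : ℕ} (h : i ≤ k) (h' : j ≤ l) :
    π.entry (k, l) ≤ π.entry (i, j) := by
  simpa [Nat.add_sub_cancel' h, Nat.add_sub_cancel' h'] using π.decreasing i j (k - i) (l - j)

theorem entry_eq_zero {π : PlanePartition} {N : ℕ} (h : π.entry.support ⊆ range N ×ˢ range N)
    {i j : ℕ} (hij : N ≤ i ∨ N ≤ j) : π.entry (i, j) = 0 := by
  refine Finsupp.notMem_support_iff.1 fun hp => ?_
  have := h hp
  simp only [mem_product, mem_range] at this
  omega

theorem reversedArray_zero_left (N : ℕ) (π : PlanePartition) (j : ℕ) :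
    π.reversedArray N 0 j = 0 := by simp [reversedArray]

theorem reversedArray_zero_right (N : ℕ) (π : PlanePartition) (i : ℕ) :
    π.reversedArray N i 0 = 0 := by simp [reversedArray]

theorem reversedArray_of_le {N : ℕ} {π : PlanePartition} {i j : ℕ}
    (hi0 : 0 < i) (hi : i ≤ N) (hj0 : 0 < j) (hj : j ≤ N) :
    π.reversedArray N i j = π.entry (N - i, N - j) := if_pos ⟨hi0, hi, hj0, hj⟩

theorem isRPP_reversedArray (N : ℕ) (π : PlanePartition) :
    IsRPP (range N ×ˢ range N) (π.reversedArray N) where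
  left := π.reversedArray_zero_right N
  top := π.reversedArray_zero_left N
  outside i j h := by
    simp only [mem_product, mem_range] at h
    exact if_neg (by omega)
  mono_row i j h := by
    simp only [mem_product, mem_range] at h
    rcases i with _ | i
    · simp [reversedArray_zero_left]
    · rw [reversedArray_of_le (by omega) (by omega) (by omega) (by omega),
        reversedArray_of_le (by omega) (by omega) (by omega) (by omega)]
      exact π.entry_le (by omega) le_rfl
  mono_col i j h := by
    simp only [mem_product, mem_range] at h
    rcases j with _ | j
    · simp [reversedArray_zero_right]
    · rw [reversedArray_of_le (by omega) (by omega) (by omega) (by omega),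
        reversedArray_of_le (by omega) (by omega) (by omega) (by omega)]
      exact π.entry_le le_rfl (by omega)

theorem bijOn_reversedArray (N : ℕ) :
    Set.BijOn (reversedArray N) {π | π.entry.support ⊆ range N ×ˢ range N}
      {F | IsRPP (range N ×ˢ range N) F} := by
  refine ⟨fun π _ => π.isRPP_reversedArray N, fun π hπ σ hσ h => ?_, fun F hF => ?_⟩
  · ext ⟨i, j⟩
    by_cases hij : N ≤ i ∨ N ≤ j
    · rw [entry_eq_zero hπ hij, entry_eq_zero hσ hij]
    · have h1 := congrFun (congrFun h (N - i)) (N - j)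
      rwa [reversedArray_of_le (by omega) (by omega) (by omega) (by omega),
        reversedArray_of_le (by omega) (by omega) (by omega) (by omega),
        show N - (N - i) = i by omega, show N - (N - j) = j by omega] at h1
  · have hzero : ∀ i j, F (N - i) (N - j) ≠ 0 → (i, j) ∈ range N ×ˢ range N := by
      intro i j h
      simp only [mem_product, mem_range]
      by_contra hij
      rcases (by omega : N - i = 0 ∨ N - j = 0) with h0 | h0
      · exact h (by rw [h0, hF.top])
      · exact h (by rw [h0, hF.left])
    -- Truncated subtraction sends the cells outside the square to the zero border of `F`, so the
    -- array `F (N - i) (N - j)` is decreasing on all of `ℕ × ℕ`.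
    have hrow : ∀ i j, F i j ≤ F (i + 1) j ∨ N ≤ i := by
      intro i j
      by_cases hi : N ≤ i
      · exact Or.inr hi
      rcases j with _ | j
      · simp [hF.left]
      by_cases hj : j < N
      · exact Or.inl (hF.mono_row i j (by simp; omega))
      · rcases i with _ | i
        · simp [hF.top]
        · exact Or.inl (by rw [hF.outside i j (by simp; omega)]; exact Nat.zero_le _)
    have hcol : ∀ i j, F i j ≤ F i (j + 1) ∨ N ≤ j := by
      intro i j
      by_cases hi : N ≤ j
      · exact Or.inr hi
      rcases i with _ | i
      · simp [hF.top]
      by_cases hj : i < N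
      · exact Or.inl (hF.mono_col i j (by simp; omega))
      · rcases j with _ | j
        · simp [hF.left]
        · exact Or.inl (by rw [hF.outside i j (by simp; omega)]; exact Nat.zero_le _)
    have hrow' : ∀ i j, F (N - (i + 1)) j ≤ F (N - i) j := by
      intro i j
      rcases lt_or_ge i N with h | h
      · have := (hrow (N - (i + 1)) j).resolve_right (by omega)
        rwa [show N - (i + 1) + 1 = N - i by omega] at this
      · rw [show N - (i + 1) = N - i by omega]
    have hcol' : ∀ i j, F i (N - (j + 1)) ≤ F i (N - j) := by
      intro i j
      rcases lt_or_ge j N with h | h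
      · have := (hcol i (N - (j + 1))).resolve_right (by omega)
        rwa [show N - (j + 1) + 1 = N - j by omega] at this
      · rw [show N - (j + 1) = N - j by omega]
    refine ⟨⟨Finsupp.onFinset (range N ×ˢ range N) (fun p => F (N - p.1) (N - p.2))
      fun p hp => hzero p.1 p.2 hp, fun i j a b => ?_⟩,
      Finsupp.support_onFinset_subset (hf := fun p hp => hzero p.1 p.2 hp), ?_⟩
    · simp only [Finsupp.onFinset_apply]
      exact (antitone_nat_of_succ_le (f := fun i => F (N - i) (N - (j + b)))
        (fun i => hrow' i _) (Nat.le_add_right i a)).trans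
        (antitone_nat_of_succ_le (f := fun j => F (N - i) (N - j))
          (fun j => hcol' _ j) (Nat.le_add_right j b))
    · funext i j
      rcases i with _ | i
      · rw [reversedArray_zero_left, hF.top]
      rcases j with _ | j
      · rw [reversedArray_zero_right, hF.left]
      by_cases h : i < N ∧ j < N
      · rw [reversedArray_of_le (by omega) (by omega) (by omega) (by omega)]
        simp only [Finsupp.onFinset_apply]
        rw [show N - (N - (i + 1)) = i + 1 by omega, show N - (N - (j + 1)) = j + 1 by omega]
      · rw [hF.outside i j (by simpa using h), reversedArray, if_neg (by omega)]

theorem diagSum_reversedArray {π : PlanePartition} {N : ℕ}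
    (h : π.entry.support ⊆ range N ×ˢ range N) {i j : ℕ} (hi : i ≤ N) (hj : j ≤ N) :
    diagSum (π.reversedArray N) i j = ∑ t ∈ range N, π.entry (N - i + t, N - j + t) := by
  rw [diagSum_eq_sum (K := N) (π.reversedArray_zero_right N) (π.reversedArray_zero_left N)
    (by omega)]
  refine sum_congr rfl fun t ht => ?_
  by_cases hij : t < i ∧ t < j
  · rw [reversedArray_of_le (by omega) (by omega) (by omega) (by omega)]
    congr 2 <;> omega
  · rw [reversedArray, if_neg (by omega), entry_eq_zero h (by omega)]

theorem wZero_eq_diagSum {π : PlanePartition} {N : ℕ}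
    (h : π.entry.support ⊆ range N ×ˢ range N) :
    π.wZero = diagSum (π.reversedArray N) N N := by
  rw [diagSum_reversedArray h le_rfl le_rfl, wZero]
  refine sum_of_injOn (fun p => p.1) ?_ ?_ ?_ ?_
  · rintro ⟨i, j⟩ hp ⟨k, l⟩ hq hpq
    simp only [coe_filter, Set.mem_ofPred_eq] at hp hq
    simp only [Prod.mk.injEq] at hpq ⊢
    omega
  · rintro ⟨i, j⟩ hp
    simp only [coe_filter, Set.mem_ofPred_eq] at hp
    have := h hp.1
    simp only [mem_product, mem_range] at this
    simpa using this.1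
  · intro t _ ht
    by_contra h0
    refine ht ⟨(t, t), ?_, rfl⟩
    simpa using h0
  · rintro ⟨i, j⟩ hp
    obtain rfl : i = j := (mem_filter.1 hp).2
    simp

theorem wMinus_eq_sum_diagSum {π : PlanePartition} {N : ℕ}
    (h : π.entry.support ⊆ range N ×ˢ range N) :
    π.wMinus = ∑ k ∈ range N, diagSum (π.reversedArray N) N k := by
  rw [← sum_range_reflect, wMinus]
  have h1 : ∀ k ∈ range N, diagSum (π.reversedArray N) N (N - 1 - k)
      = ∑ t ∈ range N, π.entry (t, k + 1 + t) := by
    intro k hk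
    rw [mem_range] at hk
    rw [diagSum_reversedArray h le_rfl (by omega), Nat.sub_self,
      show N - (N - 1 - k) = k + 1 by omega]
    simp
  rw [sum_congr rfl h1, ← sum_product' (f := fun k t => π.entry (t, k + 1 + t))]
  refine sum_of_injOn (fun p => (p.2 - p.1 - 1, p.1)) ?_ ?_ ?_ ?_
  · rintro ⟨i, j⟩ hp ⟨k, l⟩ hq hpq
    simp only [coe_filter, Set.mem_ofPred_eq] at hp hq
    simp only [Prod.mk.injEq] at hpq ⊢
    omega
  · rintro ⟨i, j⟩ hp
    simp only [coe_filter, Set.mem_ofPred_eq] at hp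
    have := h hp.1
    simp only [mem_product, mem_range] at this
    simp only [coe_product, coe_range, Set.mem_prod, Set.mem_Iio]
    omega
  · rintro ⟨k, t⟩ _ ht
    by_contra h0
    refine ht ⟨(t, k + 1 + t), ?_, ?_⟩
    · simp only [coe_filter, Set.mem_ofPred_eq, Finsupp.mem_support_iff]
      exact ⟨h0, by omega⟩
    · simp only [Prod.mk.injEq, and_true]
      omega
  · rintro ⟨i, j⟩ hp
    have hlt : i < j := (mem_filter.1 hp).2
    simp only
    congr 2
    omega

theorem wPlus_eq_sum_diagSum {π : PlanePartition} {N : ℕ}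
    (h : π.entry.support ⊆ range N ×ˢ range N) :
    π.wPlus = ∑ k ∈ range N, diagSum (π.reversedArray N) k N := by
  rw [← sum_range_reflect, wPlus]
  have h1 : ∀ k ∈ range N, diagSum (π.reversedArray N) (N - 1 - k) N
      = ∑ t ∈ range N, π.entry (k + 1 + t, t) := by
    intro k hk
    rw [mem_range] at hk
    rw [diagSum_reversedArray h (by omega) le_rfl, Nat.sub_self,
      show N - (N - 1 - k) = k + 1 by omega]
    simp
  rw [sum_congr rfl h1, ← sum_product' (f := fun k t => π.entry (k + 1 + t, t))]
  refine sum_of_injOn (fun p => (p.1 - p.2 - 1, p.2)) ?_ ?_ ?_ ?_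
  · rintro ⟨i, j⟩ hp ⟨k, l⟩ hq hpq
    simp only [coe_filter, Set.mem_ofPred_eq] at hp hq
    simp only [Prod.mk.injEq] at hpq ⊢
    omega
  · rintro ⟨i, j⟩ hp
    simp only [coe_filter, Set.mem_ofPred_eq] at hp
    have := h hp.1
    simp only [mem_product, mem_range] at this
    simp only [coe_product, coe_range, Set.mem_prod, Set.mem_Iio]
    omega
  · rintro ⟨k, t⟩ _ ht
    by_contra h0
    refine ht ⟨(k + 1 + t, t), ?_, ?_⟩
    · simp only [coe_filter, Set.mem_ofPred_eq, Finsupp.mem_support_iff]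
      exact ⟨h0, by omega⟩
    · simp only [Prod.mk.injEq, and_true]
      omega
  · rintro ⟨i, j⟩ hp
    have hlt : j < i := (mem_filter.1 hp).2
    simp only
    congr 2
    omega

/-- Plane partitions inside the `N × N` square are in bijection with multisets of cells of that
square, such that the size is the total hook length and `w₋ - w₊` is the total content. -/
theorem exists_bijOn_weight (N : ℕ) : ∃ Ψ : PlanePartition → (ℕ × ℕ →₀ ℕ),
    Set.BijOn Ψ {π | π.entry.support ⊆ range N ×ˢ range N}
      {d | d.support ⊆ range N ×ˢ range N} ∧
    ∀ π : PlanePartition, π.entry.support ⊆ range N ×ˢ range N →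
      Finsupp.weight Cell.weight (Ψ π) = ((π.w : ℤ), (π.wMinus : ℤ) - π.wPlus) := by
  have hlow : IsLowerSet ((range N ×ˢ range N : Finset (ℕ × ℕ)) : Set (ℕ × ℕ)) := by
    rintro ⟨i, j⟩ ⟨k, l⟩ hle hp
    have := Prod.mk_le_mk.1 hle
    simp only [mem_coe, mem_product, mem_range] at hp ⊢
    omega
  obtain ⟨Φ, hΦ, hsum⟩ := exists_bijOn_diagSum_eq_rectSum _ hlow
  refine ⟨fun π => reflect N (Φ (π.reversedArray N)),
    (bijOn_reflect N).comp (hΦ.comp (bijOn_reversedArray N)), fun π hπ => ?_⟩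
  have hs : ∀ i j, i ≤ N → j ≤ N → (i = N ∨ j = N) →
      rectSum (Φ (π.reversedArray N)) i j = diagSum (π.reversedArray N) i j := by
    intro i j hi hj hij
    refine (hsum _ (π.isRPP_reversedArray N) i j ?_ fun x y hx hy => ?_).symm
    · simp only [mem_product, mem_range]
      omega
    · simp only [mem_product, mem_range]
      omega
  rw [weight_reflect, w, wMinus_eq_sum_diagSum hπ, wPlus_eq_sum_diagSum hπ, wZero_eq_diagSum hπ,
    hs N N le_rfl le_rfl (Or.inl rfl),
    sum_congr rfl fun k hk => hs N k le_rfl (mem_range.1 hk).le (Or.inl rfl),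
    sum_congr rfl fun k hk => hs k N (mem_range.1 hk).le le_rfl (Or.inr rfl)]

/-- `b 0 l n` is the number of monomials of bidegree `(n, l)`, or, in terms of generating functions,
`∑ b 0 l n q ^ n t ^ l = ∏ 1 / (1 - q ^ (i + j + 1) t ^ (j - i))`, the product over all cells. -/
theorem b_zero_eq_ncard (l : ℤ) (n : ℕ) :
    b 0 l n = {d : ℕ × ℕ →₀ ℕ | Finsupp.weight Cell.weight d = ((n : ℤ), l)}.ncard := by
  obtain ⟨Ψ, hΨ, hw⟩ := exists_bijOn_weight n
  have hsub : ∀ π ∈ refinedSet 0 l n, π.entry.support ⊆ range n ×ˢ range n := by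
    rintro π ⟨rfl, -⟩
    exact π.support_subset
  have himage : Ψ '' refinedSet 0 l n = {d | Finsupp.weight Cell.weight d = ((n : ℤ), l)} := by
    ext d
    constructor
    · rintro ⟨π, hπ, rfl⟩
      have h2 := hπ.2
      rw [zero_mul, add_zero] at h2
      rw [Set.mem_ofPred_eq, hw π (hsub π hπ), hπ.1, h2]
    · intro hd
      have hd1 : (Finsupp.weight Cell.weight d).1 = n := congrArg Prod.fst hd
      obtain ⟨π, hπ, rfl⟩ := hΨ.surjOn (Cell.support_subset_of_weight_fst hd1)
      rw [Set.mem_ofPred_eq, hw π hπ, Prod.mk.injEq] at hd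
      exact ⟨π, ⟨by exact_mod_cast hd.1, by rw [zero_mul, add_zero]; exact hd.2⟩, rfl⟩
  rw [← himage, Set.InjOn.ncard_image (hΨ.injOn.mono hsub), b]

end PlanePartition

end

theorem mainTheorem9 (m n : ℕ) :
    PlanePartition.b 0 (m + 2) n ≤ PlanePartition.b 0 m n := by
  rw [PlanePartition.b_zero_eq_ncard, PlanePartition.b_zero_eq_ncard]
  exact Cell.ncard_weight_le (Nat.cast_nonneg m)
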